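/- Let $d\ge 0$ be an integer and let $P\subset\mathbb{R}^d$ be a closed convex cone (containing $0$) which is spanning, $P-P=\mathbb{R}^d$, and pointed, $P\cap(-P)=\{0\}$. Let $\mathbb{T}=\{z\in\mathbb{C}:|z|=1\}$. A multiplier on $P$ is a continuous function $\omega:P\times P\to\mathbb{T}$ with $$\omega(x,y)\,\omega(x+y,z)=\omega(x,y+z)\,\omega(y,z)\qquad\text{for all }x,y,z\in P.$$ The multipliers form an abelian group $Z^2(P,\mathbb{T})$ under pointwise multiplication. Let $B^2(P,\mathbb{T})$ be its subgroup of coboundaries $\omega_\psi(x,y)=\psi(x)\psi(y)\psi(x+y)^{-1}$, where $\psi:P\to\mathbb{T}$ is continuous, and let $H^2(P,\mathbb{T})=Z^2(P,\mathbb{T})/B^2(P,\mathbb{T})$; write $[\omega]$ for the class of $\omega\in Z^2(P,\mathbb{T})$. Let $B_0(d)$ be the additive group of strictly upper triangular real $d\times d$ matrices, and for $A\in B_0(d)$ let $\omega_A(x,y)=e^{i\langle Ax|y\rangle}$ for $x,y\in P$, where $\langle\cdot|\cdot\rangle$ is the standard inner product of $\mathbb{R}^d$; this is a multiplier on $P$.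 Then the map $$B_0(d)\to H^2(P,\mathbb{T}),\qquad A\mapsto[\omega_A],$$ is an isomorphism of groups. -/

import Mathlib

open scoped Matrix Pointwise

namespace ConeCohomology

section Cohomology

variable (S : Type*) [AddCommMonoid S] [TopologicalSpace S]

/-- The group `Z²(S, 𝕋)` of multipliers on `S`: continuous functions `ω : S × S → 𝕋` with
`ω(x, y) ω(x + y, z) = ω(x, y + z) ω(y, z)`, under pointwise multiplication. -/
noncomputable def Z2 : Subgroup C(S × S, Circle) where
  carrier := {ω | ∀ x y z : S, ω (x, y) * ω (x + y, z) = ω (x, y + z) * ω (y, z)}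
  one_mem' := by intro x y z; simp
  mul_mem' := by
    intro a b ha hb x y z
    simp only [ContinuousMap.mul_apply]
    rw [mul_mul_mul_comm, ha x y z, hb x y z, mul_mul_mul_comm]
  inv_mem' := by
    intro a ha x y z
    have h := congrArg (fun t : Circle => t⁻¹) (ha x y z)
    simp only [mul_inv] at h
    exact h

variable [ContinuousAdd S]

/-- The coboundary map `ψ ↦ ω_ψ`, `ω_ψ(x, y) = ψ(x) ψ(y) ψ(x + y)⁻¹`, defined on continuous
functions `ψ : S → 𝕋`. -/
noncomputable def coboundary : C(S, Circle) →* Z2 S where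
  toFun ψ :=
    ⟨⟨fun p => ψ p.1 * ψ p.2 * (ψ (p.1 + p.2))⁻¹, by fun_prop⟩, by
      intro x y z
      simp only [ContinuousMap.coe_mk, add_assoc]
      have h : ∀ a b c d e f : Circle,
          a * b * d⁻¹ * (d * c * f⁻¹) = a * e * f⁻¹ * (b * c * e⁻¹) := by
        intro a b c d e f
        calc a * b * d⁻¹ * (d * c * f⁻¹) = a * b * c * f⁻¹ * (d⁻¹ * d) := by
              simp only [mul_comm, mul_left_comm, mul_assoc]
          _ = a * b * c * f⁻¹ * (e⁻¹ * e) := by rw [inv_mul_cancel, inv_mul_cancel]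
          _ = a * e * f⁻¹ * (b * c * e⁻¹) := by
              simp only [mul_comm, mul_left_comm, mul_assoc]
      exact h _ _ _ _ _ _⟩
  map_one' := by
    ext p; simp
  map_mul' ψ φ := by
    ext p
    simp
    ring

/-- The subgroup `B²(S, 𝕋)` of coboundaries. -/
noncomputable def B2 : Subgroup (Z2 S) := (coboundary S).range

/-- The continuous second cohomology group `H²(S, 𝕋) = Z²(S, 𝕋) / B²(S, 𝕋)`. -/
abbrev H2 : Type _ := Z2 S ⧸ B2 S

end Cohomology

/-- The additive group `B₀(d)` of strictly upper triangular real `d × d` matrices. -/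
def strictUpper (d : ℕ) : AddSubgroup (Matrix (Fin d) (Fin d) ℝ) where
  carrier := {A | ∀ i j, j ≤ i → A i j = 0}
  zero_mem' := by intro i j _; rfl
  add_mem' := by
    intro A B hA hB i j hij
    simp [hA i j hij, hB i j hij]
  neg_mem' := by
    intro A hA i j hij
    simp [hA i j hij]

instance {d : ℕ} (P : PointedCone ℝ (EuclideanSpace ℝ (Fin d))) : ContinuousAdd P :=
  inferInstanceAs (ContinuousAdd P.toAddSubmonoid)

/-- The multiplier `ω_A(x, y) = exp(i ⟨A x | y⟩)` on the cone `P`. -/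
noncomputable def omega {d : ℕ} (P : PointedCone ℝ (EuclideanSpace ℝ (Fin d)))
    (A : Matrix (Fin d) (Fin d) ℝ) : Z2 P :=
  ⟨⟨fun p => Circle.exp (inner ℝ (Matrix.toEuclideanLin A (p.1 : EuclideanSpace ℝ (Fin d)))
      (p.2 : EuclideanSpace ℝ (Fin d))), by
      have h : Continuous (Matrix.toEuclideanLin A) := LinearMap.continuous_of_finiteDimensional _
      fun_prop⟩, by
    intro x y z
    simp only [ContinuousMap.coe_mk, ← Circle.exp_add]
    congr 1
    simp only [Submodule.coe_add, map_add, inner_add_left, inner_add_right]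
    ring⟩

end ConeCohomology

/-! Since `P × P` is contractible, a multiplier lifts to a real cocycle `c` (`exists_real_cocycle`).
Its antisymmetrization `c(x,y) - c(y,x)` is biadditive and continuous, so it extends to a skew
bilinear form on the whole space (`exists_bilinear_extension`), and every skew form is `⟨Ax|y⟩ -
⟨Ay|x⟩` for some strictly upper triangular `A`. Then `c - ⟨Ax|y⟩` is a symmetric real cocycle, and
surjectivity reduces to showing that such a cocycle `s` is a continuous coboundary.

Averaging over a bump in the interior of `P` changes `s` by a coboundary and yields a factor `‖y‖`;
a second averaging, combined with symmetry, gives `|s(x,y)| ≤ C‖x‖‖y‖` on bounded sets. If `s(x,y) =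
G(x+y) - G(x) - G(y)` with `G` of second order at 0, then `G(x) = 2G(x/2) + s(x/2,x/2)`; iterating
gives a series for `G`, which the bound makes converge.

Injectivity: coboundaries are symmetric, so if `ω_A` is one, the skew form of `A` takes values in
`2πℤ` on `P × P`; scaling `x` forces it to vanish. -/

namespace ConeCohomology

open MeasureTheory Filter Topology

/-! ### Symmetric real cocycles are coboundaries -/

section SymmetricCocycle

variable {E : Type*} [NormedAddCommGroup E] [NormedSpace ℝ E]

/-- A continuous real function on `E × E` which is a symmetric `2`-cocycle on the cone `P`. -/
structure IsSymmCocycle (P : PointedCone ℝ E) (s : E → E → ℝ) : Prop where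
  cont : Continuous fun p : E × E => s p.1 p.2
  symm : ∀ x ∈ P, ∀ y ∈ P, s x y = s y x
  cocycle : ∀ x ∈ P, ∀ y ∈ P, ∀ z ∈ P, s x y + s (x + y) z = s x (y + z) + s y z

variable {P : PointedCone ℝ E} {s : E → E → ℝ}

theorem IsSymmCocycle.add_coboundary (hs : IsSymmCocycle P s) {f : E → ℝ} (hf : Continuous f) :
    IsSymmCocycle P fun x y => s x y + f (x + y) - f x - f y where
  cont := by
    have := hs.cont
    fun_prop
  symm x hx y hy := by
    simp only [hs.symm x hx y hy, add_comm x y]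
    ring
  cocycle x hx y hy z hz := by
    have := hs.cocycle x hx y hy z hz
    simp only [add_assoc x y z]
    linarith

/-- Were `s` the coboundary of `G`, both sides would expand to the same combination of values of
`G`. This identity makes the series for `G` telescope. -/
theorem IsSymmCocycle.two_smul (hs : IsSymmCocycle P s) {u v : E} (hu : u ∈ P) (hv : v ∈ P) :
    s (u + v) (u + v) - s u u - s v v = s ((2 : ℝ) • u) ((2 : ℝ) • v) - 2 * s u v := by
  have huv := P.add_mem hu hv
  have h1 := hs.cocycle u hu v hv (u + v) huv
  have h2 := hs.cocycle u hu u hu (v + v) (P.add_mem hv hv)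
  have h3 := hs.cocycle u hu v hv v hv
  have h4 := hs.symm (u + v) huv v hv
  rw [show v + (u + v) = u + (v + v) by abel] at h1
  simp only [_root_.two_smul]
  linarith

/-- A symmetric cocycle which vanishes to second order at the origin is a coboundary. -/
theorem IsSymmCocycle.exists_eq_coboundary_of_bound (hs : IsSymmCocycle P s)
    (hb : ∀ R : ℝ, ∃ C : ℝ, ∀ x ∈ P, ∀ y ∈ P, ‖x‖ ≤ R → ‖y‖ ≤ R → |s x y| ≤ C * ‖x‖ * ‖y‖) :
    ∃ G : E → ℝ, ContinuousOn G P ∧ ∀ x ∈ P, ∀ y ∈ P, s x y = G (x + y) - G x - G y := by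
  set r : ℕ → ℝ := fun n => (1 / 2) ^ n with hr
  have r0 : ∀ n, 0 ≤ r n := fun n => by positivity
  have r1 : ∀ n, r n ≤ 1 := fun n => pow_le_one₀ (by norm_num) (by norm_num)
  have r2 : ∀ n, (2 : ℝ) ^ n * r n = 1 := fun n => by simp [hr]
  have rs : ∀ n, r n = 2 * r (n + 1) := fun n => by simp only [hr, pow_succ]; ring
  -- The bound contributes `(r n)²`, of which the weight `2 ^ n` consumes only one factor.
  have key : ∀ R : ℝ, ∃ C : ℝ, ∀ n, ∀ x ∈ P, ∀ y ∈ P, ‖x‖ ≤ R → ‖y‖ ≤ R →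
      ‖(2 : ℝ) ^ n * s (r n • x) (r n • y)‖ ≤ C * r n := by
    intro R
    obtain ⟨C, hC⟩ := hb R
    refine ⟨|C| * |R| * |R|, fun n x hx y hy hxR hyR => ?_⟩
    have hn : ∀ z : E, ‖z‖ ≤ R → ‖r n • z‖ ≤ R := fun z hz => by
      rw [norm_smul, Real.norm_of_nonneg (r0 n)]
      exact (mul_le_of_le_one_left (norm_nonneg _) (r1 n)).trans hz
    have h := hC _ (P.smul_mem (r0 n) hx) _ (P.smul_mem (r0 n) hy) (hn x hxR) (hn y hyR)
    rw [norm_mul, norm_pow, Real.norm_ofNat, Real.norm_eq_abs]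
    simp only [norm_smul, Real.norm_of_nonneg (r0 n)] at h
    calc (2 : ℝ) ^ n * |s (r n • x) (r n • y)|
        ≤ 2 ^ n * (|C| * (r n * |R|) * (r n * |R|)) := by
          refine mul_le_mul_of_nonneg_left (h.trans ?_) (by positivity)
          have := r0 n
          have hx' := hxR.trans (le_abs_self R)
          have hy' := hyR.trans (le_abs_self R)
          gcongr
          exact le_abs_self C
      _ = (2 ^ n * r n) * (|C| * |R| * |R| * r n) := by ring
      _ = |C| * |R| * |R| * r n := by rw [r2, one_mul]
  have rsum : Summable r := summable_geometric_of_lt_one (by norm_num) (by norm_num)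
  -- Terms of the series obtained by iterating `G(x) = 2G(x/2) + s(x/2,x/2)`.
  set u : ℕ → E → ℝ := fun n x => (2 : ℝ) ^ n * s (r (n + 1) • x) (r (n + 1) • x) with hu
  have ubound : ∀ R : ℝ, ∃ C : ℝ, ∀ n, ∀ x ∈ P, ‖x‖ ≤ R → ‖u n x‖ ≤ C * r (n + 1) := by
    intro R
    obtain ⟨C, hC⟩ := key R
    refine ⟨C, fun n x hx hxR => ?_⟩
    refine le_trans ?_ (hC (n + 1) x hx x hx hxR hxR)
    simp only [hu, norm_mul]
    gcongr
    rw [norm_pow, norm_pow]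
    exact pow_le_pow_right₀ (by norm_num) (by simp)
  have rsum' : ∀ C : ℝ, Summable fun n => C * r (n + 1) := fun C =>
    ((summable_nat_add_iff 1).2 rsum).mul_left C
  have usum : ∀ x ∈ P, Summable fun n => u n x := fun x hx => by
    obtain ⟨C, hC⟩ := ubound ‖x‖
    exact Summable.of_norm_bounded (rsum' C) fun n => hC n x hx le_rfl
  refine ⟨fun x => ∑' n, u n x, ?_, ?_⟩
  · intro x hx
    obtain ⟨C, hC⟩ := ubound (‖x‖ + 1)
    have hc : ContinuousOn (fun x => ∑' n, u n x) (P ∩ Metric.closedBall 0 (‖x‖ + 1)) := by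
      refine continuousOn_tsum (fun n => ?_) (rsum' C) fun n y hy => hC n y hy.1 ?_
      · have := hs.cont
        exact Continuous.continuousOn (continuous_const.mul
          (this.comp ((continuous_const_smul (r (n + 1))).prodMk
            (continuous_const_smul (r (n + 1))))))
      · simpa using hy.2
    refine (continuousWithinAt_inter ?_).1 (hc x ⟨hx, by simp⟩)
    refine mem_of_superset (Metric.ball_mem_nhds x one_pos) fun y hy => ?_
    rw [mem_closedBall_zero_iff]
    rw [mem_ball_iff_norm] at hy
    linarith [norm_le_norm_add_norm_sub' y x]
  · intro x hx y hy
    have hsum := ((usum _ (P.add_mem hx hy)).hasSum.sub (usum x hx).hasSum).sub (usum y hy).hasSum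
    set a : ℕ → ℝ := fun n => (2 : ℝ) ^ n * s (r n • x) (r n • y) with ha
    have hterm : ∀ n, u n (x + y) - u n x - u n y = a n - a (n + 1) := by
      intro n
      have h := hs.two_smul (P.smul_mem (r0 (n + 1)) hx) (P.smul_mem (r0 (n + 1)) hy)
      rw [smul_smul, smul_smul, ← rs n] at h
      simp only [hu, ha, smul_add, pow_succ]
      linear_combination (2 : ℝ) ^ n * h
    have ha0 : Tendsto a atTop (𝓝 0) := by
      obtain ⟨C, hC⟩ := key (max ‖x‖ ‖y‖)
      refine squeeze_zero_norm (fun n => hC n x hx y hy (le_max_left _ _) (le_max_right _ _)) ?_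
      simpa using rsum.tendsto_atTop_zero.const_mul C
    have h1 := hsum.tendsto_sum_nat
    simp only [hterm, Finset.sum_range_sub'] at h1
    have h2 := tendsto_nhds_unique h1 (ha0.const_sub (a 0))
    simpa [ha, hr] using h2.symm

variable [FiniteDimensional ℝ E]

/-- Averaging a symmetric cocycle against a Lipschitz density on the cone adds a coboundary to it
and makes it Lipschitz near the origin. -/
theorem exists_average_bound (hP : (interior (P : Set E)).Nonempty) :
    ∃ (L : ℝ → ℝ) (ρ : ℝ), ∀ s : E → E → ℝ, IsSymmCocycle P s → ∃ f : E → ℝ, Continuous f ∧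
      ∀ R M : ℝ, ∀ x ∈ P, ∀ y ∈ P, ‖y‖ ≤ R → (∀ w ∈ P, ‖w‖ ≤ ρ + R → |s x w| ≤ M) →
        |s x y + f (x + y) - f x - f y| ≤ L R * M * ‖y‖ := by
  borelize E
  obtain ⟨p, hp⟩ := hP
  obtain ⟨r, hr, hrP⟩ := Metric.isOpen_iff.1 isOpen_interior p hp
  replace hrP : Metric.ball p r ⊆ P := hrP.trans interior_subset
  let μ : Measure E := Measure.addHaar
  set φ : E → ℝ := fun w => max 0 (r - ‖w - p‖) with hφ
  have φc : Continuous φ := by fun_prop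
  have φ0 : ∀ w, 0 ≤ φ w := fun w => le_max_left _ _
  have φz : ∀ w, r ≤ ‖w - p‖ → φ w = 0 := fun w hw => max_eq_left (by linarith)
  have φP : ∀ w, w ∉ P → φ w = 0 := fun w hw => φz w <| by
    by_contra! h
    exact hw (hrP (by rwa [mem_ball_iff_norm]))
  have φl : ∀ w y, |φ (w - y) - φ w| ≤ ‖y‖ := by
    intro w y
    simp only [hφ, max_comm (0 : ℝ)]
    refine (abs_max_sub_max_le_abs _ _ 0).trans ?_
    rw [show r - ‖w - y - p‖ - (r - ‖w - p‖) = ‖w - p‖ - ‖w - y - p‖ by ring]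
    refine (abs_norm_sub_norm_le _ _).trans_eq ?_
    congr 1
    abel
  have φs : HasCompactSupport φ := HasCompactSupport.intro (isCompact_closedBall p r) fun w hw =>
    φz w (by rw [mem_closedBall_iff_norm] at hw; linarith)
  have φi : ∀ g : E → ℝ, Continuous g → Integrable (fun w => φ w * g w) μ := fun g hg =>
    (φc.mul hg).integrable_of_hasCompactSupport φs.mul_right
  set c : ℝ := ∫ w, φ w ∂μ with hc
  have c0 : 0 < c := by
    refine φc.integral_pos_of_hasCompactSupport_nonneg_nonzero φs φ0 (x := p) ?_
    simp [hφ, hr.not_ge]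
  refine ⟨fun R => c⁻¹ * μ.real (Metric.closedBall p (r + R)), ‖p‖ + r, fun s hs =>
    ⟨fun x => c⁻¹ * ∫ z, φ z * s x z ∂μ, ?_, ?_⟩⟩
  · refine continuous_const.mul ?_
    have h := hs.cont
    have h1 := continuous_parametric_integral_of_continuous (μ := μ) (f := fun x z => φ z * s x z)
      (by unfold Function.uncurry; fun_prop) (isCompact_closedBall p r)
    convert h1 using 2 with x
    refine (setIntegral_eq_integral_of_forall_compl_eq_zero fun z hz => ?_).symm
    rw [φz z (by rw [mem_closedBall_iff_norm] at hz; linarith), zero_mul]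
  · intro R M x hx y hy hyR hM
    -- Integrating the cocycle identity in `z` against `φ` and translating by `y` leaves `c⁻¹ ∫
    -- (φ(w-y) - φ(w)) s(x,w) dw`; the Lipschitz bound on `φ` supplies the factor `‖y‖`.
    have sc : ∀ x, Continuous (s x) := fun x => hs.cont.comp (.prodMk_right x)
    have e1 : s x y * c + ∫ z, φ z * s (x + y) z ∂μ
        = (∫ z, φ z * s x (y + z) ∂μ) + ∫ z, φ z * s y z ∂μ := by
      rw [hc, ← integral_const_mul, ← integral_add, ← integral_add]
      · refine integral_congr_ae (.of_forall fun z => ?_)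
        by_cases hz : z ∈ P
        · have := hs.cocycle x hx y hy z hz
          simp only
          linear_combination φ z * this
        · simp [φP z hz]
      · exact φi _ ((sc x).comp (by fun_prop))
      · exact φi _ (sc y)
      · exact (φc.integrable_of_hasCompactSupport φs).const_mul _
      · exact φi _ (sc _)
    have e2 : ∫ z, φ z * s x (y + z) ∂μ = ∫ w, φ (w - y) * s x w ∂μ := by
      rw [← integral_sub_right_eq_self (fun z => φ z * s x (y + z)) y]
      simp
    have i2 : Integrable (fun w => φ (w - y) * s x w) μ := by
      have := (φi (fun z => s x (y + z)) ((sc x).comp (by fun_prop))).comp_sub_right y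
      simpa using this
    have e3 : s x y + c⁻¹ * (∫ z, φ z * s (x + y) z ∂μ) - c⁻¹ * (∫ z, φ z * s x z ∂μ)
        - c⁻¹ * (∫ z, φ z * s y z ∂μ) = c⁻¹ * ∫ w, (φ (w - y) - φ w) * s x w ∂μ := by
      simp only [sub_mul]
      rw [integral_sub i2 (φi _ (sc x)), ← e2]
      field_simp
      linarith
    have zero_out : ∀ w, w ∉ Metric.closedBall p (r + R) → φ (w - y) - φ w = 0 := by
      intro w hw
      rw [mem_closedBall_iff_norm, not_le] at hw
      have hR := (norm_nonneg y).trans hyR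
      have h1 : ‖w - p‖ ≤ ‖w - y - p‖ + ‖y‖ := by
        refine (norm_add_le (w - y - p) y).trans_eq' ?_
        congr 1
        abel
      rw [φz w (by linarith), φz (w - y) (by linarith), sub_zero]
    have hbound : ∀ w ∈ Metric.closedBall p (r + R),
        ‖(φ (w - y) - φ w) * s x w‖ ≤ ‖y‖ * M := by
      intro w hw
      have hM0 : 0 ≤ M := (abs_nonneg _).trans (hM 0 P.zero_mem (by
        have := (norm_nonneg y).trans hyR
        simp only [norm_zero]
        positivity))
      by_cases hwP : w ∈ P
      · rw [norm_mul]
        refine mul_le_mul (φl w y) (hM w hwP ?_) (norm_nonneg _) (norm_nonneg _)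
        rw [mem_closedBall_iff_norm] at hw
        linarith [norm_le_norm_add_norm_sub' w p]
      -- Off the cone nothing is known about `s x w`, but there both densities vanish because `y ∈
      -- P`.
      · have : w - y ∉ P := fun h => hwP (by simpa using P.add_mem h hy)
        rw [φP w hwP, φP _ this]
        simpa using mul_nonneg (norm_nonneg y) hM0
    rw [e3, ← setIntegral_eq_integral_of_forall_compl_eq_zero
      (s := Metric.closedBall p (r + R)) fun w hw => by rw [zero_out w hw, zero_mul], abs_mul,
      abs_of_pos (inv_pos.2 c0)]
    have h := norm_setIntegral_le_of_norm_le_const (μ := μ)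
      (isCompact_closedBall p (r + R)).measure_lt_top hbound
    rw [Real.norm_eq_abs] at h
    calc _ ≤ c⁻¹ * (‖y‖ * M * μ.real (Metric.closedBall p (r + R))) := by gcongr
      _ = _ := by ring

/-- A continuous symmetric real cocycle on a cone with interior points is a continuous
coboundary. -/
theorem IsSymmCocycle.exists_eq_coboundary (hP : (interior (P : Set E)).Nonempty)
    (hs : IsSymmCocycle P s) :
    ∃ G : E → ℝ, ContinuousOn G P ∧ ∀ x ∈ P, ∀ y ∈ P, s x y = G (x + y) - G x - G y := by
  obtain ⟨L, ρ, h⟩ := exists_average_bound hP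
  obtain ⟨f, hf, hfb⟩ := h s hs
  have hs' := hs.add_coboundary hf
  obtain ⟨g, hg, hgb⟩ := h _ hs'
  obtain ⟨G, hG, hGs⟩ := (hs'.add_coboundary hg).exists_eq_coboundary_of_bound <| by
    intro R
    obtain ⟨M, hM⟩ := ((isCompact_closedBall (0 : E) (ρ + R)).prod
      (isCompact_closedBall (0 : E) (ρ + R))).exists_bound_of_continuousOn hs.cont.continuousOn
    refine ⟨L R * (L R * M), fun x hx y hy hxR hyR => ?_⟩
    refine (hgb R (L R * M * ‖x‖) x hx y hy hyR fun w hw hwR => ?_).trans_eq (by ring)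
    -- The first averaging gives smallness in the second argument; symmetry moves it to the first
    -- before the second averaging.
    rw [hs'.symm x hx w hw]
    exact hfb R M w hw x hx hxR fun z hz hzR => hM (w, z) ⟨by simpa using hwR, by simpa using hzR⟩
  refine ⟨fun x => G x - f x - g x, (hG.sub hf.continuousOn).sub hg.continuousOn,
    fun x hx y hy => ?_⟩
  linarith [hGs x hx y hy]

end SymmetricCocycle

/-! ### Lifting to the real line and extending from the cone -/

/-- A continuous circle-valued function on a contractible space has a continuous argument. -/
theorem exists_continuous_arg {X : Type*} [TopologicalSpace X] [ContractibleSpace X]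
    (ω : C(X, Circle)) : ∃ c : C(X, ℝ), ∀ x, Circle.exp (c x) = ω x := by
  obtain ⟨y, ⟨H⟩⟩ := id_nullhomotopic X
  obtain ⟨t, ht⟩ := Circle.exp_surjective (ω y)
  -- The contraction is run backwards, from a constant map, whose lift is the constant `t`, to the
  -- identity.
  let K : C(unitInterval × X, Circle) := ω.comp H.symm.toContinuousMap
  have K0 : ∀ x, K (0, x) = Circle.exp (ContinuousMap.const X t x) := fun x => by
    simp [K, ht]
  let cov := Circle.isCoveringMap_exp
  refine ⟨(cov.liftHomotopy K _ K0).comp (.prodMk (.const X 1) (.id X)), fun x => ?_⟩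
  have h := congrFun (cov.liftHomotopy_lifts K _ K0) (1, x)
  simpa [K] using h

section Cone

variable {E : Type*} [NormedAddCommGroup E] [NormedSpace ℝ E] {P : PointedCone ℝ E}

instance (P : PointedCone ℝ E) : ContractibleSpace P :=
  Convex.contractibleSpace (s := (P : Set E)) P.convex ⟨0, P.zero_mem⟩

theorem interior_nonempty_of_sub_eq_univ [FiniteDimensional ℝ E]
    (hspan : (P : Set E) - (P : Set E) = Set.univ) : (interior (P : Set E)).Nonempty := by
  rw [P.convex.interior_nonempty_iff_affineSpan_eq_top,
    AffineSubspace.affineSpan_eq_top_iff_vectorSpan_eq_top_of_nonempty _ _ _ ⟨0, P.zero_mem⟩,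
    vectorSpan_def]
  refine (congrArg _ hspan).trans Submodule.span_univ

/-- A continuous additive map on a generating cone with interior points extends to a continuous
linear map. -/
theorem exists_continuousLinearMap_extension {F : Type*} [NormedAddCommGroup F] [NormedSpace ℝ F]
    (hspan : (P : Set E) - (P : Set E) = Set.univ) (hP : (interior (P : Set E)).Nonempty)
    (h : P → F) (hc : Continuous h) (hadd : ∀ x y, h (x + y) = h x + h y) :
    ∃ T : E →L[ℝ] F, ∀ x : P, T x = h x := by
  have hex : ∀ x : E, ∃ u v : P, (u : E) - v = x := fun x => by
    obtain ⟨u, hu, v, hv, huv⟩ := Set.mem_sub.1 (hspan ▸ Set.mem_univ x : x ∈ (P : Set E) - P)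
    exact ⟨⟨u, hu⟩, ⟨v, hv⟩, huv⟩
  choose u v huv using hex
  have key : ∀ (x : E) (a b : P), (a : E) - b = x → h (u x) - h (v x) = h a - h b := by
    intro x a b hab
    have h1 : u x + b = a + v x := Subtype.ext <| by
      have := (huv x).trans hab.symm
      rw [sub_eq_sub_iff_add_eq_add] at this
      simpa using this
    have h2 := congrArg h h1
    rw [hadd, hadd] at h2
    rw [sub_eq_sub_iff_add_eq_add, h2]
  -- The map `u - v ↦ h u - h v`, independent of the decomposition by `key`. Continuity at the
  -- interior point `p` is later translated to 0.
  let T : E →+ F := AddMonoidHom.mk' (fun x => h (u x) - h (v x)) fun x y => by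
    rw [key (x + y) (u x + u y) (v x + v y), hadd, hadd]
    · abel
    · rw [Submodule.coe_add, Submodule.coe_add, add_sub_add_comm, huv, huv]
  have hTP : ∀ x : P, T x = h x := fun x => by
    have h0 : h 0 = 0 := by simpa using hadd 0 0
    have := key x x 0 (by simp)
    simpa [T, h0] using this
  obtain ⟨p, hp⟩ := hP
  have hT : Continuous T := by
    have hon : ContinuousOn T P :=
      continuousOn_iff_continuous_domRestrict.2 (hc.congr fun x => (hTP x).symm)
    have hat : ContinuousAt T (0 + p) := by
      rw [zero_add]
      exact hon.continuousAt (mem_interior_iff_mem_nhds.1 hp)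
    refine continuous_of_continuousAt_zero T ?_
    have hat' : ContinuousAt (fun x => T (x + p) - T p) 0 :=
      (ContinuousAt.comp (f := fun x => x + p) hat (by fun_prop)).sub continuousAt_const
    simpa using hat'
  exact ⟨T.toRealLinearMap hT, hTP⟩

theorem linearMap_ext_cone {F : Type*} [NormedAddCommGroup F] [NormedSpace ℝ F]
    (hspan : (P : Set E) - (P : Set E) = Set.univ) {S T : E →L[ℝ] F}
    (h : ∀ x ∈ P, S x = T x) : S = T := by
  ext x
  obtain ⟨u, hu, v, hv, rfl⟩ := Set.mem_sub.1 (hspan ▸ Set.mem_univ x : x ∈ (P : Set E) - P)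
  rw [map_sub, map_sub, h u hu, h v hv]

/-- A continuous biadditive function on a generating cone extends to a bilinear form. -/
theorem exists_bilinear_extension [FiniteDimensional ℝ E]
    (hspan : (P : Set E) - (P : Set E) = Set.univ) (σ : P → P → ℝ)
    (hc : Continuous fun p : P × P => σ p.1 p.2)
    (hl : ∀ x y z, σ (x + y) z = σ x z + σ y z) (hr : ∀ x y z, σ x (y + z) = σ x y + σ x z) :
    ∃ B : E →L[ℝ] E →L[ℝ] ℝ, ∀ x y : P, B x y = σ x y := by
  have hP := interior_nonempty_of_sub_eq_univ hspan
  choose T hT using fun x : P => exists_continuousLinearMap_extension hspan hP (σ x)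
    (hc.comp (.prodMk_right x)) (hr x)
  obtain ⟨B, hB⟩ := exists_continuousLinearMap_extension hspan hP T
    (continuous_clm_apply.2 fun y => by
      obtain ⟨u, hu, v, hv, rfl⟩ := Set.mem_sub.1 (hspan ▸ Set.mem_univ y : y ∈ (P : Set E) - P)
      have h1 : Continuous fun x => σ x ⟨u, hu⟩ := hc.comp (.prodMk_left _)
      have h2 : Continuous fun x => σ x ⟨v, hv⟩ := hc.comp (.prodMk_left _)
      refine (h1.sub h2).congr fun x => ?_
      simp [← hT])
    fun x y => linearMap_ext_cone hspan fun z hz => by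
      have := hl x y ⟨z, hz⟩
      rwa [← hT, ← hT, ← hT] at this
  exact ⟨B, fun x y => by rw [hB, hT]⟩

theorem bilinear_eq_of_eq_on_cone (hspan : (P : Set E) - (P : Set E) = Set.univ)
    {B B' : E →L[ℝ] E →L[ℝ] ℝ} (h : ∀ x ∈ P, ∀ y ∈ P, B x y = B' x y) : B = B' :=
  linearMap_ext_cone hspan fun x hx => linearMap_ext_cone hspan (h x hx)

/-- Both sides of the additive identity lift the same circle-valued function on the connected space
`P × P × P` and agree at the origin, hence everywhere. -/
theorem exists_real_cocycle (ω : Z2 P) :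
    ∃ c : C(P × P, ℝ), (∀ p, Circle.exp (c p) = (ω : C(P × P, Circle)) p) ∧
      ∀ x y z, c (x, y) + c (x + y, z) = c (x, y + z) + c (y, z) := by
  obtain ⟨c, hc⟩ := exists_continuous_arg (ω : C(P × P, Circle))
  refine ⟨c, hc, fun x y z => ?_⟩
  have : ContinuousAdd P := inferInstanceAs (ContinuousAdd P.toAddSubmonoid)
  have h := Circle.isCoveringMap_exp.eq_of_comp_eq (A := P × P × P)
    (g₁ := fun q => c (q.1, q.2.1) + c (q.1 + q.2.1, q.2.2))
    (g₂ := fun q => c (q.1, q.2.1 + q.2.2) + c (q.2.1, q.2.2))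
    (by fun_prop) (by fun_prop)
    (by
      ext1 q
      simp only [Function.comp_apply, Circle.exp_add, hc]
      exact ω.2 _ _ _)
    0 (by simp)
  exact congrFun h (x, y, z)

end Cone

/-! ### Skew forms and strictly upper triangular matrices -/

section Matrices

variable {d : ℕ}

/-- The skew-symmetric bilinear form `⟨A x | y⟩ - ⟨A y | x⟩`. -/
noncomputable def skewForm (A : Matrix (Fin d) (Fin d) ℝ) :
    EuclideanSpace ℝ (Fin d) →L[ℝ] EuclideanSpace ℝ (Fin d) →L[ℝ] ℝ :=
  let T : EuclideanSpace ℝ (Fin d) →L[ℝ] EuclideanSpace ℝ (Fin d) →L[ℝ] ℝ :=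
    (innerSL ℝ : EuclideanSpace ℝ (Fin d) →L[ℝ] EuclideanSpace ℝ (Fin d) →L[ℝ] ℝ).comp
      (Matrix.toEuclideanLin A).toContinuousLinearMap
  T - T.flip

theorem skewForm_apply (A : Matrix (Fin d) (Fin d) ℝ) (x y : EuclideanSpace ℝ (Fin d)) :
    skewForm A x y
      = inner ℝ (Matrix.toEuclideanLin A x) y - inner ℝ (Matrix.toEuclideanLin A y) x := by
  simp [skewForm]

theorem skewForm_single (A : Matrix (Fin d) (Fin d) ℝ) (i j : Fin d) :
    skewForm A (EuclideanSpace.single i 1) (EuclideanSpace.single j 1) = A j i - A i j := by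
  simp [skewForm_apply, Matrix.toLpLin_apply, EuclideanSpace.inner_single_right]

theorem eq_zero_of_skewForm_eq_zero {A : Matrix (Fin d) (Fin d) ℝ} (hA : A ∈ strictUpper d)
    (h : skewForm A = 0) : A = 0 := by
  ext i j
  rcases le_or_gt j i with hij | hij
  · exact hA i j hij
  · have := skewForm_single A i j
    rw [h, hA j i hij.le] at this
    simpa using this.symm

theorem exists_skewForm_eq
    (B : EuclideanSpace ℝ (Fin d) →L[ℝ] EuclideanSpace ℝ (Fin d) →L[ℝ] ℝ)
    (hB : ∀ x y, B x y = -B y x) : ∃ A ∈ strictUpper d, skewForm A = B := by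
  let e : Fin d → EuclideanSpace ℝ (Fin d) := fun i => EuclideanSpace.single i 1
  -- The indices are swapped because `skewForm A` at `(e i, e j)` is `A j i - A i j`.
  refine ⟨Matrix.of fun i j => if i < j then B (e j) (e i) else 0, fun i j hij => ?_, ?_⟩
  · simp [hij.not_gt]
  · refine ContinuousLinearMap.coe_injective
      ((EuclideanSpace.basisFun (Fin d) ℝ).toBasis.ext fun i => ?_)
    refine ContinuousLinearMap.coe_injective
      ((EuclideanSpace.basisFun (Fin d) ℝ).toBasis.ext fun j => ?_)
    have h := hB (e i) (e j)
    simp only [OrthonormalBasis.coe_toBasis, EuclideanSpace.basisFun_apply,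
      ContinuousLinearMap.coe_coe, skewForm_single, Matrix.of_apply]
    rcases lt_trichotomy i j with hij | rfl | hij
    · simp [hij, hij.not_gt, h, e]
    · have : B (e i) (e i) = 0 := by linarith
      simpa using this.symm
    · simp [hij, hij.not_gt, e]

/-! ### The class map and its bijectivity -/

variable (P : PointedCone ℝ (EuclideanSpace ℝ (Fin d)))

/-- The homomorphism `A ↦ [ω_A]`. -/
noncomputable def omegaClass : Multiplicative (strictUpper d) →* H2 P where
  toFun A := QuotientGroup.mk (omega P (A.toAdd : Matrix (Fin d) (Fin d) ℝ))
  map_one' := by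
    rw [← QuotientGroup.mk_one]
    congr 1
    ext p
    simp [omega]
  map_mul' A A' := by
    rw [← QuotientGroup.mk_mul]
    congr 1
    ext p
    simp [omega, inner_add_left, Circle.exp_add]

variable {P}

theorem eq_zero_of_forall_exp_mul_eq_one {a : ℝ} (h : ∀ t : ℝ, 0 ≤ t → Circle.exp (t * a) = 1) :
    a = 0 := by
  by_contra ha
  -- This `t` makes `t * a = ±π`, where the exponential is `-1`.
  have h1 := h (Real.pi / |a|) (by positivity)
  have h2 : ∀ u : ℝ, u = Real.pi ∨ u = -Real.pi → Circle.exp u ≠ 1 := by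
    rintro u (rfl | rfl) hu
    · have := congrArg (fun z : Circle => (z : ℂ)) hu
      norm_num [Complex.exp_pi_mul_I] at this
    · rw [Circle.exp_neg, inv_eq_one] at hu
      have := congrArg (fun z : Circle => (z : ℂ)) hu
      norm_num [Complex.exp_pi_mul_I] at this
  refine h2 _ ?_ h1
  rcases abs_cases a with ⟨h, -⟩ | ⟨h, -⟩
  · left
    rw [h]
    field_simp
  · right
    rw [h]
    field_simp

theorem omegaClass_injective
    (hspan : (P : Set (EuclideanSpace ℝ (Fin d))) - (P : Set (EuclideanSpace ℝ (Fin d)))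
      = Set.univ) : Function.Injective (omegaClass P) := by
  refine (injective_iff_map_eq_one _).2 fun A hA => ?_
  obtain ⟨ψ, hψ⟩ := (QuotientGroup.eq_one_iff _).1 hA
  have hval : ∀ x y : P, ψ x * ψ y * (ψ (x + y))⁻¹ =
      Circle.exp (inner ℝ (Matrix.toEuclideanLin (A.toAdd : Matrix (Fin d) (Fin d) ℝ) x)
        (y : EuclideanSpace ℝ (Fin d))) := fun x y =>
    congrArg (fun ω : Z2 P => (ω : C(P × P, Circle)) (x, y)) hψ
  have hone : ∀ x y : P, Circle.exp (skewForm (A.toAdd : Matrix (Fin d) (Fin d) ℝ) x y) = 1 := by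
    intro x y
    rw [skewForm_apply, Circle.exp_sub, ← hval x y, ← hval y x, add_comm y x, mul_comm (ψ y),
      div_self']
  have hzero : skewForm (A.toAdd : Matrix (Fin d) (Fin d) ℝ) = 0 := by
    refine bilinear_eq_of_eq_on_cone hspan fun x hx y hy => ?_
    refine eq_zero_of_forall_exp_mul_eq_one fun t ht => ?_
    simpa using hone ⟨t • x, P.smul_mem ht hx⟩ ⟨y, hy⟩
  exact Subtype.ext (eq_zero_of_skewForm_eq_zero A.toAdd.2 hzero)

theorem omegaClass_surjective (hclosed : IsClosed (P : Set (EuclideanSpace ℝ (Fin d))))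
    (hspan : (P : Set (EuclideanSpace ℝ (Fin d))) - (P : Set (EuclideanSpace ℝ (Fin d)))
      = Set.univ) : Function.Surjective (omegaClass P) := by
  intro q
  obtain ⟨ω, rfl⟩ := QuotientGroup.mk_surjective q
  obtain ⟨c, hc, hcc⟩ := exists_real_cocycle ω
  -- Additivity of the antisymmetrization is the cocycle identity at `(x,y,z)` plus that at
  -- `(z,x,y)` minus that at `(x,z,y)`.
  have hl : ∀ x y z : P, c (x + y, z) - c (z, x + y)
      = c (x, z) - c (z, x) + (c (y, z) - c (z, y)) := by
    intro x y z
    have h1 := hcc x y z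
    have h2 := hcc z x y
    have h3 := hcc x z y
    rw [add_comm z x] at h2
    rw [add_comm z y] at h3
    linarith
  obtain ⟨B, hB⟩ := exists_bilinear_extension hspan (fun x y : P => c (x, y) - c (y, x))
    (c.continuous.sub (c.continuous.comp continuous_swap)) hl fun x y z => by linarith [hl y z x]
  obtain ⟨A, hA, hAB⟩ := exists_skewForm_eq B fun x y => by
    have h : B = -B.flip := bilinear_eq_of_eq_on_cone hspan fun x hx y hy => by
      have h1 := hB ⟨x, hx⟩ ⟨y, hy⟩
      have h2 := hB ⟨y, hy⟩ ⟨x, hx⟩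
      simp only [neg_apply, ContinuousLinearMap.flip_apply] at *
      linarith
    exact DFunLike.congr_fun (DFunLike.congr_fun h x) y
  let b : C(P × P, ℝ) := ⟨fun p => inner ℝ (Matrix.toEuclideanLin A p.1)
    (p.2 : EuclideanSpace ℝ (Fin d)), by
      have h : Continuous (Matrix.toEuclideanLin A) := LinearMap.continuous_of_finiteDimensional _
      fun_prop⟩
  have hemb : Topology.IsClosedEmbedding (Prod.map ((↑) : P → EuclideanSpace ℝ (Fin d))
      ((↑) : P → EuclideanSpace ℝ (Fin d))) :=
    hclosed.isClosedEmbedding_subtypeVal.prodMap hclosed.isClosedEmbedding_subtypeVal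
  -- Tietze extension from the closed set `P × P`: the averaging integrates a function continuous on
  -- the whole space. The extension need be a cocycle only on `P`.
  obtain ⟨s, hs⟩ := (c - b).exists_extension' hemb
  have hsP : ∀ x y : P, s (x, y) = c (x, y) - inner ℝ (Matrix.toEuclideanLin A x)
      (y : EuclideanSpace ℝ (Fin d)) := fun x y => congrFun hs (x, y)
  have hsymm : IsSymmCocycle P fun x y => s (x, y) :=
    { cont := s.continuous
      symm := fun x hx y hy => by
        have h1 := hsP ⟨x, hx⟩ ⟨y, hy⟩
        have h2 := hsP ⟨y, hy⟩ ⟨x, hx⟩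
        have h3 := skewForm_apply A x y
        rw [hAB] at h3
        have h4 := hB ⟨x, hx⟩ ⟨y, hy⟩
        simp only at *
        linarith
      cocycle := fun x hx y hy z hz => by
        have h := hcc ⟨x, hx⟩ ⟨y, hy⟩ ⟨z, hz⟩
        have h1 := hsP ⟨x, hx⟩ ⟨y, hy⟩
        have h2 := hsP (⟨x, hx⟩ + ⟨y, hy⟩) ⟨z, hz⟩
        have h3 := hsP ⟨x, hx⟩ (⟨y, hy⟩ + ⟨z, hz⟩)
        have h4 := hsP ⟨y, hy⟩ ⟨z, hz⟩
        simp only [Submodule.coe_add, map_add, inner_add_left, inner_add_right] at *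
        linarith }
  obtain ⟨G, hG, hGs⟩ := hsymm.exists_eq_coboundary (interior_nonempty_of_sub_eq_univ hspan)
  have hGc : Continuous fun x : P => -G x := (continuousOn_iff_continuous_domRestrict.1 hG).neg
  -- The sign in `exp(-G)` reconciles `G(x+y) - G(x) - G(y)` with the convention `ψ(x)ψ(y)ψ(x+y)⁻¹`.
  refine ⟨Multiplicative.ofAdd ⟨A, hA⟩, QuotientGroup.eq.2
    ⟨⟨fun x : P => Circle.exp (-G x), Circle.exp.continuous.comp hGc⟩, ?_⟩⟩
  ext1
  ext1 ⟨x, y⟩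
  have h1 : (coboundary P ⟨fun x : P => Circle.exp (-G x), Circle.exp.continuous.comp hGc⟩ :
      C(P × P, Circle)) (x, y) = Circle.exp (c (x, y) - inner ℝ (Matrix.toEuclideanLin A x)
      (y : EuclideanSpace ℝ (Fin d))) := by
    rw [← hsP, hGs x x.2 y y.2]
    simp only [coboundary, MonoidHom.coe_mk, OneHom.coe_mk, ContinuousMap.coe_mk,
      ← Circle.exp_neg, ← Circle.exp_add, Submodule.coe_add]
    congr 1
    ring
  rw [h1, Circle.exp_sub, hc, div_eq_inv_mul]
  rfl

end Matrices

end ConeCohomology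

theorem mainTheorem6 (d : ℕ) (P : PointedCone ℝ (EuclideanSpace ℝ (Fin d)))
    (hclosed : IsClosed (P : Set (EuclideanSpace ℝ (Fin d))))
    (hspan : (P : Set (EuclideanSpace ℝ (Fin d))) - (P : Set (EuclideanSpace ℝ (Fin d)))
      = Set.univ)
    (hpointed : (P : Set (EuclideanSpace ℝ (Fin d))) ∩ -(P : Set (EuclideanSpace ℝ (Fin d)))
      = {0}) :
    ∃ Φ : Multiplicative (ConeCohomology.strictUpper d) ≃* ConeCohomology.H2 P,
      ∀ A : ConeCohomology.strictUpper d,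
        Φ (Multiplicative.ofAdd A)
          = QuotientGroup.mk (ConeCohomology.omega P (A : Matrix (Fin d) (Fin d) ℝ)) :=
  ⟨MulEquiv.ofBijective (ConeCohomology.omegaClass P)
    ⟨ConeCohomology.omegaClass_injective hspan,
      ConeCohomology.omegaClass_surjective hclosed hspan⟩, fun _ => rfl⟩
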